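/- Let $(K,v)$ be a Henselian discrete valued field (that is, $v(K)\cong\mathbb Z$, and $v$ extends uniquely, up to equivalence, to a valuation of each algebraic extension of $K$), with valuation ring $O_v(K)$ and residue field $\widehat K$ of characteristic $p>0$; for $a\in O_v(K)$ let $\hat a\in\widehat K$ be its residue, and let $\widehat K^{p}$ be the subfield of $p$-th powers in $\widehat K$. Let $\mu\in\mathbb N$, and let $M/K$ be a finite Galois extension whose Galois group is abelian of period (exponent) $p$ and order $p^{\mu}$, and which is totally ramified, i.e. $v$ has, up to equivalence, a unique prolongation $v_M$ to $M$ and the index of $v(K)$ in $v_M(M)$ equals $[M\colon K]$. Let $L_1,\dots,L_\mu$ be extensions of $K$ in $M$ of degree $p$ with compositum $L_1\cdots L_\mu=M$ (each $L_j/K$ is then cyclic), let $\sigma_j$ be a generator of the Galois group of $L_j/K$, and let $a_1,\dots,a_\mu\in O_v(K)^{*}$ be units such that $\hat a_1,\dots,\hat a_\mu$ are $p$-independent over $\widehat K^{p}$, i.e. $[\widehat K^{p}(\hat a_1,\dots,\hat a_\mu)\colon\widehat K^{p}]=p^{\mu}$. Let $\Delta_j=(L_j/K,\sigma_j,a_j)$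 be the cyclic $K$-algebra $\bigoplus_{i=0}^{p-1}L_jx_j^{i}$ with $x_j^{p}=a_j$ and $x_jl=\sigma_j(l)x_j$ for $l\in L_j$. Then $D_\mu=\Delta_1\otimes_K\cdots\otimes_K\Delta_\mu$ is a finite-dimensional central division algebra over $K$. Moreover, $v$ extends to a valuation $v_{D_\mu}$ of $D_\mu$, unique up to equivalence, and its residue algebra $\widehat D_\mu$ is isomorphic, as a $\widehat K$-algebra, to the splitting field over $\widehat K$ of the polynomial $\prod_{j=1}^{\mu}(X^{p}-\hat a_j)$, i.e. to the field obtained from $\widehat K$ by adjoining $p$-th roots of $\hat a_1,\dots,\hat a_\mu$; in particular $[\widehat D_\mu\colon\widehat K]=p^{\mu}$. -/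

import Mathlib

open scoped TensorProduct Polynomial

universe u

noncomputable section

/-! ### Valuations: Henselian valuations, totally ramified extensions, residue rings -/

/-- A valuation `v` of a field `K` is Henselian if it extends uniquely, up to equivalence, to
a valuation of each algebraic field extension `L` of `K`. (Equivalence classes of valuations of
`L` are represented by the valuation subrings of `L`. Every algebraic extension of `K` is
isomorphic to one in the universe of `K`.) -/
def Valuation.IsHenselian {K : Type u} [Field K] {Γ₀ : Type*} [LinearOrderedCommGroupWithZero Γ₀]
    (v : Valuation K Γ₀) : Prop :=
  ∀ (L : Type u) [Field L] [Algebra K L] [Algebra.IsAlgebraic K L],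
    ∃! W : ValuationSubring L, v.HasExtension W.valuation

/-- A finite extension `M / K` is totally ramified with respect to a valuation `v` of `K` if `v`
has, up to equivalence, a unique prolongation to `M`, and the value group of `K` has index
`[M : K]` in the value group of this prolongation. -/
def Valuation.IsTotallyRamified {K : Type*} [Field K] {Γ₀ : Type*}
    [LinearOrderedCommGroupWithZero Γ₀] (v : Valuation K Γ₀) (M : Type*) [Field M] [Algebra K M]
    [FiniteDimensional K M] : Prop :=
  ∃ W : ValuationSubring M, v.HasExtension W.valuation ∧
    (∀ W' : ValuationSubring M, v.HasExtension W'.valuation → W' = W) ∧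
    (MonoidWithZeroHom.valueGroup (.ofClass (W.valuation.comap (algebraMap K M)))).relIndex
      (MonoidWithZeroHom.valueGroup (.ofClass W.valuation)) = Module.finrank K M

namespace Valuation

section Residue

variable {D : Type*} [Ring D] {Γ : Type*} [LinearOrderedCommGroupWithZero Γ]

/-- The ideal `{x | w x < 1}` of the valuation ring `{x | w x ≤ 1}` of `w`. The ring `D` need not
be commutative. -/
def integerIdeal (w : Valuation D Γ) : Ideal w.integer where
  carrier := {x | w x < 1}
  zero_mem' := by simp
  add_mem' {x y} hx hy := lt_of_le_of_lt (w.map_add x y) (max_lt hx hy)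
  smul_mem' c x hx := by
    have hc : w c ≤ 1 := c.2
    have hx' : w x < 1 := hx
    change w ((c : D) * x) < 1
    rw [map_mul]
    exact lt_of_le_of_lt (mul_le_mul_left hc _) (by simpa using hx')

instance (w : Valuation D Γ) : w.integerIdeal.IsTwoSided where
  mul_mem_of_left {x} c hx := by
    have hc : w c ≤ 1 := c.2
    have hx' : w x < 1 := hx
    change w ((x : D) * c) < 1
    rw [map_mul]
    exact lt_of_le_of_lt (mul_le_mul_right hc _) (by simpa using hx')

/-- The residue ring of a valuation `w` of a (not necessarily commutative) division ring. -/
def ResidueRing (w : Valuation D Γ) : Type _ := w.integer ⧸ w.integerIdeal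

instance (w : Valuation D Γ) : Ring w.ResidueRing :=
  inferInstanceAs (Ring (w.integer ⧸ w.integerIdeal))

/-- The residue homomorphism of the valuation ring. -/
def toResidueRing (w : Valuation D Γ) : w.integer →+* w.ResidueRing :=
  Ideal.Quotient.mk w.integerIdeal

variable {K : Type*} [Field K] [Algebra K D] {Γ₀ : Type*} [LinearOrderedCommGroupWithZero Γ₀]

/-- The residue field of a valuation of a field. -/
abbrev ResField (v : Valuation K Γ₀) : Type _ := IsLocalRing.ResidueField v.valuationSubring

/-- If `w` extends `v`, the inclusion of valuation rings induces a map on residue rings. -/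
def residueMap (v : Valuation K Γ₀) (w : Valuation D Γ) [v.HasExtension w] :
    v.ResField →+* w.ResidueRing :=
  Ideal.Quotient.lift (IsLocalRing.maximalIdeal v.valuationSubring)
    (w.toResidueRing.comp
      (algebraMap v.integer w.integer : v.valuationSubring →+* w.integer)) (by
    intro x hx
    have hx' : v (x : K) < 1 := (Valuation.Integer.not_isUnit_iff_valuation_lt_one (v := v)).1 hx
    exact Ideal.Quotient.eq_zero_iff_mem.2
      ((HasExtension.val_map_lt_one_iff v w (x : K)).2 hx'))

/-- The residue ring of an extension `w` of `v` to a `K`-algebra is an algebra over the residue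
field of `v`. -/
instance (v : Valuation K Γ₀) (w : Valuation D Γ) [v.HasExtension w] :
    Algebra v.ResField w.ResidueRing :=
  (residueMap v w).toAlgebra' (by
    intro c x
    obtain ⟨c, rfl⟩ := Ideal.Quotient.mk_surjective c
    obtain ⟨x, rfl⟩ := Ideal.Quotient.mk_surjective x
    exact congrArg w.toResidueRing
      (Subtype.ext (Algebra.commutes (c : K) (x : D))))

end Residue

end Valuation

/-! ### Cyclic algebras -/

section Cyclic

variable {K L : Type*} [Field K] [Field L] [Algebra K L]

/-- The cyclic algebra `(L / K, σ, a)`, where `L / K` is a finite cyclic extension of degree `n`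
and `σ` a generator of its Galois group (so that `n = orderOf σ`): the left `L`-vector space with
basis `1, x, …, x ^ (n - 1)`, with `x ^ n = a` and `x * l = σ l * x` for `l ∈ L`. The element
with coefficients `f : Fin n → L` stands for `∑ i, f i * x ^ i`. -/
@[ext]
structure CyclicAlgebra (σ : Gal(L/K)) (a : K) where
  coeff : Fin (orderOf σ) → L

namespace CyclicAlgebra

/-- An element is the same as its tuple of coefficients. -/
def equivFun (σ : Gal(L/K)) (a : K) : CyclicAlgebra σ a ≃ (Fin (orderOf σ) → L) where
  toFun f := f.coeff
  invFun f := ⟨f⟩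

variable {σ : Gal(L/K)} {a : K}

instance : AddCommGroup (CyclicAlgebra σ a) := (equivFun σ a).addCommGroup

instance : Module K (CyclicAlgebra σ a) := (equivFun σ a).module K

theorem coeff_add (f g : CyclicAlgebra σ a) (i : Fin (orderOf σ)) :
    (f + g).coeff i = f.coeff i + g.coeff i := rfl

theorem coeff_zero (i : Fin (orderOf σ)) : (0 : CyclicAlgebra σ a).coeff i = 0 := rfl

theorem coeff_smul (c : K) (f : CyclicAlgebra σ a) (i : Fin (orderOf σ)) :
    (c • f).coeff i = c • f.coeff i := rfl

variable (a) in
/-- The element `l * x ^ i`, as an additive function of `l`. -/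
def monomial (i : Fin (orderOf σ)) : L →+ CyclicAlgebra σ a where
  toFun l := ⟨Pi.single i l⟩
  map_zero' := congrArg mk (Pi.single_zero i)
  map_add' l m := congrArg mk (Pi.single_add (f := fun _ => L) i l m)

theorem coeff_monomial (i j : Fin (orderOf σ)) (l : L) :
    (monomial a i l).coeff j = if j = i then l else 0 := Pi.single_apply i l j

theorem coeff_sum {ι : Type*} (s : Finset ι) (f : ι → CyclicAlgebra σ a) (i : Fin (orderOf σ)) :
    (∑ k ∈ s, f k).coeff i = ∑ k ∈ s, (f k).coeff i :=
  map_sum (AddMonoidHom.mk' (fun g : CyclicAlgebra σ a => g.coeff i) fun _ _ => rfl) f s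

theorem sum_monomial (f : CyclicAlgebra σ a) : ∑ i, monomial a i (f.coeff i) = f := by
  ext j
  simp [coeff_sum, coeff_monomial]

variable (a) in
/-- The scalar `c` in `x ^ i * x ^ j = c * x ^ ((i + j) mod n)`. -/
def carry (i j : Fin (orderOf σ)) : L :=
  if i.val + j.val < orderOf σ then 1 else algebraMap K L a

/-- The multiplication determined by `(l * x ^ i) * (m * x ^ j) = l * σ ^ i (m) * x ^ (i + j)`
and `x ^ n = a`. (Addition in `Fin n` is modulo `n`.) -/
instance : Mul (CyclicAlgebra σ a) where
  mul f g := ∑ i, ∑ j,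
    monomial a (i + j) (f.coeff i * (σ ^ i.val) (g.coeff j) * carry a i j)

theorem mul_def (f g : CyclicAlgebra σ a) : f * g =
    ∑ i, ∑ j, monomial a (i + j) (f.coeff i * (σ ^ i.val) (g.coeff j) * carry a i j) := rfl

instance : NonUnitalNonAssocRing (CyclicAlgebra σ a) where
  left_distrib f g h := by
    simp only [mul_def, coeff_add, map_add, mul_add, add_mul, Finset.sum_add_distrib]
  right_distrib f g h := by
    simp only [mul_def, coeff_add, map_add, add_mul, Finset.sum_add_distrib]
  zero_mul f := by
    simp [mul_def, coeff_zero]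
  mul_zero f := by
    simp [mul_def, coeff_zero]

theorem monomial_mul_monomial (i j : Fin (orderOf σ)) (l m : L) :
    monomial a i l * monomial a j m =
      monomial a (i + j) (l * (σ ^ i.val) m * carry a i j) := by
  rw [mul_def, Finset.sum_eq_single i, Finset.sum_eq_single j]
  · simp only [coeff_monomial, if_true]
  · intro k _ hk
    simp only [coeff_monomial, if_neg hk, map_zero, mul_zero, zero_mul]
  · simp
  · intro k _ hk
    simp only [coeff_monomial, if_neg hk, map_zero, zero_mul, Finset.sum_const_zero]
  · simp

theorem carry_assoc (i j k : Fin (orderOf σ)) :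
    carry a i j * carry a (i + j) k = carry a j k * carry a i (j + k) := by
  have hi := i.2
  have hj := j.2
  have hk := k.2
  have h1 : (i + j).val = if i.val + j.val < orderOf σ then i.val + j.val
      else i.val + j.val - orderOf σ := by
    rw [Fin.val_add]
    split_ifs with h
    · exact Nat.mod_eq_of_lt h
    · rw [Nat.mod_eq_sub_mod (by omega), Nat.mod_eq_of_lt (by omega)]
  have h2 : (j + k).val = if j.val + k.val < orderOf σ then j.val + k.val
      else j.val + k.val - orderOf σ := by
    rw [Fin.val_add]
    split_ifs with h
    · exact Nat.mod_eq_of_lt h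
    · rw [Nat.mod_eq_sub_mod (by omega), Nat.mod_eq_of_lt (by omega)]
  unfold carry
  rw [h1, h2]
  split_ifs <;> first | rfl | (exfalso; omega) | simp

theorem pow_carry (i j k : Fin (orderOf σ)) : (σ ^ i.val) (carry a j k) = carry a j k := by
  unfold carry
  split_ifs
  · exact map_one _
  · exact (σ ^ i.val).commutes a

theorem pow_add_apply (i j : Fin (orderOf σ)) (l : L) :
    (σ ^ (i + j).val) l = (σ ^ i.val) ((σ ^ j.val) l) := by
  rw [Fin.val_add, pow_mod_orderOf, pow_add, AlgEquiv.mul_apply]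

theorem monomial_mul_assoc (i j k : Fin (orderOf σ)) (l m n : L) :
    monomial a i l * monomial a j m * monomial a k n =
      monomial a i l * (monomial a j m * monomial a k n) := by
  simp only [monomial_mul_monomial, map_mul, pow_carry, pow_add_apply]
  have hij : i + j + k = i + (j + k) := by
    ext
    simp [Fin.val_add, add_assoc]
  rw [hij]
  congr 1
  linear_combination l * (σ ^ i.val) m * (σ ^ i.val) ((σ ^ j.val) n) * carry_assoc (a := a) i j k

protected theorem mul_assoc (f g h : CyclicAlgebra σ a) : f * g * h = f * (g * h) := by
  rw [← sum_monomial f, ← sum_monomial g, ← sum_monomial h]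
  simp only [Finset.sum_mul]
  refine Finset.sum_congr rfl fun i _ => ?_
  rw [Finset.mul_sum (s := Finset.univ) (a := monomial a i (f.coeff i)),
    Finset.sum_mul, Finset.mul_sum (s := Finset.univ) (a := monomial a i (f.coeff i))]
  refine Finset.sum_congr rfl fun j _ => ?_
  rw [Finset.mul_sum, Finset.mul_sum, Finset.mul_sum]
  exact Finset.sum_congr rfl fun k _ => monomial_mul_assoc i j k _ _ _

variable [FiniteDimensional K L]

instance : NeZero (orderOf σ) := ⟨(orderOf_pos σ).ne'⟩

instance : One (CyclicAlgebra σ a) := ⟨monomial a 0 1⟩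

theorem one_def : (1 : CyclicAlgebra σ a) = monomial a 0 1 := rfl

instance : Ring (CyclicAlgebra σ a) where
  __ := (inferInstance : NonUnitalNonAssocRing (CyclicAlgebra σ a))
  mul_assoc := CyclicAlgebra.mul_assoc
  one_mul f := by
    rw [← sum_monomial f, Finset.mul_sum]
    refine Finset.sum_congr rfl fun i _ => ?_
    rw [one_def, monomial_mul_monomial]
    simp [carry]
  mul_one f := by
    rw [← sum_monomial f, Finset.sum_mul]
    refine Finset.sum_congr rfl fun i _ => ?_
    rw [one_def, monomial_mul_monomial]
    simp [carry]

theorem smul_monomial (c : K) (i : Fin (orderOf σ)) (l : L) :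
    c • monomial a i l = monomial a i (c • l) := by
  ext j
  simp [coeff_smul, coeff_monomial]

instance : Algebra K (CyclicAlgebra σ a) :=
  Algebra.ofModule
    (fun c f g => by
      rw [← sum_monomial f, ← sum_monomial g]
      simp only [Finset.sum_mul, Finset.mul_sum, Finset.smul_sum, smul_monomial,
        monomial_mul_monomial, smul_mul_assoc])
    (fun c f g => by
      rw [← sum_monomial f, ← sum_monomial g]
      simp only [Finset.sum_mul, Finset.mul_sum, Finset.smul_sum, smul_monomial,
        monomial_mul_monomial, map_smul, mul_smul_comm, smul_mul_assoc])

end CyclicAlgebra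

end Cyclic

/-! ### Central division algebras and `p`-independence -/

/-- `D` is an (associative) finite-dimensional central division algebra over `K`. -/
structure IsCentralDivisionAlgebra (K D : Type*) [Field K] [Ring D] [Algebra K D] : Prop where
  finiteDimensional : FiniteDimensional K D
  isCentral : Algebra.IsCentral K D
  nontrivial : Nontrivial D
  isUnit : ∀ x : D, x ≠ 0 → IsUnit x

/-- Elements `b 0, …, b (m - 1)` of a field `k` of characteristic `p` are `p`-independent over the
subfield `k ^ p` of `p`-th powers if `k ^ p (b 0, …, b (m - 1))` is an extension of `k ^ p` of
degree `p ^ m`. -/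
def IsPIndependent {k : Type*} [Field k] (p : ℕ) [ExpChar k p] {m : ℕ} (b : Fin m → k) : Prop :=
  Module.finrank (frobenius k p).fieldRange
    (IntermediateField.adjoin (frobenius k p).fieldRange (Set.range b)) = p ^ m

end

/-! By a dimension count `M` is the tensor product of the `L j`, so `D` is the direct sum of the `M
* X i`, where `X i` is the tensor of the powers `x_j ^ i j`. This is a crossed product of `M` with
its Galois group whose cocycle takes values in `K`, each value being a product of some of the `a j`.
Centrality is then the usual computation with coordinates.

Total ramification enters through residues: `M` has the same residue field as `K`, so the Galois
group preserves the valuation `w` of `M` and acts trivially on residues. Give an element of `D` the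
maximum of the values of its coordinates. On the unit ball, reducing coordinates sends `X i` to `β i
= ∏ α j ^ i j`, with `α j` a `p`-th root of the residue of `a j`. The twist by the Galois group
disappears, so this reduction is multiplicative with values in the splitting field `F`. By
`p`-independence the `β i` form a basis of `F`, hence an element reduces to zero exactly when its
value is below 1. As `F` has no zero divisors, the maximum is multiplicative
(`HasGoodReduction.supValue_mul`): it is a valuation extending `v`, its residue ring is `F`, and the
finite-dimensional algebra `D`, having no zero divisors, is a division algebra.

For uniqueness, two extensions of `v` to `D` are compared on each commutative subfield `K[x]`, where
the Henselian property applies. -/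

noncomputable section

/-! ### Totally ramified extensions: residues and the Galois action -/

namespace Valuation

/-- If the nonzero terms of a finite sum have distinct values, no cancellation occurs. -/
theorem le_map_sum_of_injOn {R Γ ι : Type*} [Ring R] [LinearOrderedCommGroupWithZero Γ]
    (w : Valuation R Γ) (s : Finset ι) (f : ι → R)
    (hf : ∀ i ∈ s, ∀ j ∈ s, w (f i) ≠ 0 → w (f i) = w (f j) → i = j) {i : ι} (hi : i ∈ s) :
    w (f i) ≤ w (∑ j ∈ s, f j) := by
  classical
  obtain ⟨j, hj, hmax⟩ := s.exists_max_image (fun j => w (f j)) ⟨i, hi⟩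
  refine (hmax i hi).trans ?_
  by_cases h0 : w (f j) = 0
  · simp [h0]
  rw [← Finset.add_sum_erase s f hj, w.map_add_eq_of_lt_left]
  refine w.map_sum_lt h0 fun k hk => ?_
  rw [Finset.mem_erase] at hk
  exact lt_of_le_of_ne (hmax k hk.2) fun h => hk.1 (hf j hj k hk.2 h0 h.symm).symm

section TotallyRamified

variable {K M Γ₀ Γ : Type*} [Field K] [Field M] [Algebra K M]
  [LinearOrderedCommGroupWithZero Γ₀] [LinearOrderedCommGroupWithZero Γ]

/-- If the ramification index equals the degree, then residues do not grow. -/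
theorem exists_map_sub_algebraMap_lt_one [FiniteDimensional K M] (w : Valuation M Γ)
    (h : (MonoidWithZeroHom.valueGroup (.ofClass (w.comap (algebraMap K M)))).relIndex
      (MonoidWithZeroHom.valueGroup (.ofClass w)) = Module.finrank K M)
    {m : M} (hm : w m ≤ 1) : ∃ c : K, w (m - algebraMap K M c) < 1 := by
  classical
  rcases hm.lt_or_eq with hm | hm
  · exact ⟨0, by simpa using hm⟩
  set H := MonoidWithZeroHom.valueGroup
    (.ofClass (w.comap (algebraMap K M)) : K →*₀ Γ) with hH
  set G := MonoidWithZeroHom.valueGroup (.ofClass w : M →*₀ Γ) with hG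
  have hcard : Nat.card (G ⧸ H.subgroupOf G) = Module.finrank K M := h
  have hpos : 0 < Module.finrank K M := Module.finrank_pos
  -- An infinite index would count as 0, while the degree is positive.
  have : Finite (G ⧸ H.subgroupOf G) := Nat.finite_of_card_ne_zero (by omega)
  have : Fintype (G ⧸ H.subgroupOf G) := Fintype.ofFinite _
  have key : ∀ q : G ⧸ H.subgroupOf G, ∃ y : M, ∃ hy : w y ≠ 0, ∃ hy' : Units.mk0 (w y) hy ∈ G,
      (QuotientGroup.mk ⟨_, hy'⟩ : G ⧸ H.subgroupOf G) = q := by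
    intro q
    obtain ⟨⟨g, hg⟩, rfl⟩ := QuotientGroup.mk_surjective q
    have hg' := hg
    rw [hG, ← SetLike.mem_coe, ← MonoidWithZeroHom.valueMonoid_eq_valueGroup'] at hg'
    obtain ⟨y, hy⟩ := hg'
    have hy : w y = (g : Γ) := hy
    have hne : w y ≠ 0 := by rw [hy]; exact g.ne_zero
    have he : Units.mk0 (w y) hne = g := Units.ext hy
    exact ⟨y, hne, he ▸ hg, by congr 2⟩
  choose y hy hy' hyq using key
  -- Scaling by `K` does not move the value out of its coset, so nonzero multiples of different
  -- representatives `y q` never share a value.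
  have hdist : ∀ q q' (c c' : K), w (c • y q) ≠ 0 → w (c • y q) = w (c' • y q') → q = q' := by
    intro q q' c c' h0 he
    have h0' := h0
    rw [he] at h0'
    simp only [Algebra.smul_def, map_mul] at he h0 h0'
    rw [← hyq q, ← hyq q', QuotientGroup.eq, Subgroup.mem_subgroupOf]
    have hc := left_ne_zero_of_mul h0
    have hc' := left_ne_zero_of_mul h0'
    have m1 : Units.mk0 _ hc ∈ H := MonoidWithZeroHom.mem_valueGroup _ ⟨c, rfl⟩
    have m2 : Units.mk0 _ hc' ∈ H := MonoidWithZeroHom.mem_valueGroup _ ⟨c', rfl⟩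
    convert H.mul_mem m1 (H.inv_mem m2) using 1
    ext
    have := hy q
    have := hy q'
    simp
    field_simp
    rw [mul_comm, ← he, mul_comm]
  have hli : LinearIndependent K y := by
    rw [Fintype.linearIndependent_iff]
    intro g hg q
    have := le_map_sum_of_injOn w Finset.univ (fun q => g q • y q)
      (fun i _ j _ h1 h2 => hdist i j _ _ h1 h2) (Finset.mem_univ q)
    rw [hg, map_zero, le_zero_iff, Algebra.smul_def, map_mul] at this
    have h1 := (mul_eq_zero.1 this).resolve_right (hy q)
    simpa using h1
  let b := basisOfLinearIndependentOfCardEqFinrank hli (by rw [← hcard, Nat.card_eq_fintype_card])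
  -- The representative of the trivial coset need not be 1, so `m * y q₀` is expanded in the basis
  -- instead of `m`. Since `w m = 1`, no term exceeds `w (y q₀)`, and only the term at `q₀` can
  -- reach it; its coefficient is the required residue.
  let q₀ : G ⧸ H.subgroupOf G := 1
  let c := b.repr (m * y q₀)
  have hsum : ∑ q, c q • y q = m * y q₀ := by
    have := b.sum_repr (m * y q₀)
    rwa [coe_basisOfLinearIndependentOfCardEqFinrank] at this
  have hle : ∀ q, w (c q • y q) ≤ w (y q₀) := by
    intro q
    have := le_map_sum_of_injOn w Finset.univ (fun q => c q • y q)
      (fun i _ j _ h1 h2 => hdist i j _ _ h1 h2) (Finset.mem_univ q)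
    rwa [hsum, map_mul, hm, one_mul] at this
  refine ⟨c q₀, ?_⟩
  have hlt : w ((m - algebraMap K M (c q₀)) * y q₀) < w (y q₀) := by
    rw [sub_mul, ← hsum, ← Algebra.smul_def, ← Finset.add_sum_erase _ _ (Finset.mem_univ q₀),
      add_sub_cancel_left]
    refine w.map_sum_lt (hy q₀) fun q hq => lt_of_le_of_ne (hle q) fun he => ?_
    refine (Finset.mem_erase.1 hq).1 (hdist q q₀ (c q) 1 (he ▸ hy q₀) ?_)
    rw [he, one_smul]
  rw [map_mul] at hlt
  exact lt_of_mul_lt_mul_right (by simpa using hlt) zero_le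

/-- Uniqueness of the prolongation makes the conjugate of the valuation by `τ` equivalent to it.
Equivalence becomes equality because `τ` has finite order: a strict decrease at `m` would persist
under all iterates up to `τ ^ orderOf τ = 1`. -/
theorem map_algEquiv_eq [FiniteDimensional K M] (v : Valuation K Γ₀) (W : ValuationSubring M)
    [v.HasExtension W.valuation]
    (h : ∀ W' : ValuationSubring M, v.HasExtension W'.valuation → W' = W)
    (τ : Gal(M/K)) (m : M) : W.valuation (τ m) = W.valuation m := by
  have hiso : ∀ τ : Gal(M/K), (W.valuation.comap (τ : M →+* M)).IsEquiv W.valuation := by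
    intro τ
    have he : v.HasExtension (W.valuation.comap (τ : M →+* M)).valuationSubring.valuation := by
      constructor
      have h1 : v.IsEquiv ((W.valuation.comap (τ : M →+* M)).comap (algebraMap K M)) := by
        have h2 : (τ : M →+* M).comp (algebraMap K M) = algebraMap K M :=
          RingHom.ext fun x => τ.commutes x
        rw [← comap_comp, h2]
        exact HasExtension.val_isEquiv_comap
      exact h1.trans ((isEquiv_valuation_valuationSubring _).comap _)
    have := h _ he
    have h2 := isEquiv_valuation_valuationSubring (W.valuation.comap (τ : M →+* M))
    rwa [this] at h2
  have hlt : ∀ τ : Gal(M/K), ∀ m, ¬ W.valuation (τ m) < W.valuation m := by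
    intro τ m hm
    have hk : ∀ k : ℕ, W.valuation ((τ ^ (k + 1)) m) < W.valuation m := by
      intro k
      induction k with
      | zero => simpa using hm
      | succ k ih =>
        rw [pow_succ', AlgEquiv.mul_apply]
        exact (((hiso τ).lt_iff_lt (x := (τ ^ (k + 1)) m) (y := m)).2 ih).trans hm
    have := hk (orderOf τ - 1)
    rw [Nat.sub_add_cancel (orderOf_pos τ), pow_orderOf_eq_one] at this
    exact lt_irrefl _ this
  refine le_antisymm (not_lt.1 fun hh => hlt τ⁻¹ (τ m) ?_) (not_lt.1 (hlt τ m))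
  rw [← AlgEquiv.mul_apply, inv_mul_cancel]
  exact hh

/-- A residue map on the valuation ring of `w`, with values in the residue field of `v`, extended
by an arbitrary value to the whole field. -/
structure IsResidueMap (v : Valuation K Γ₀) (w : Valuation M Γ) (r : M → v.ResField) : Prop where
  map_add : ∀ x y, w x ≤ 1 → w y ≤ 1 → r (x + y) = r x + r y
  map_mul : ∀ x y, w x ≤ 1 → w y ≤ 1 → r (x * y) = r x * r y
  map_algebraMap : ∀ c : v.valuationSubring,
    r (algebraMap K M c) = IsLocalRing.residue v.valuationSubring c
  eq_zero_iff : ∀ x, w x ≤ 1 → (r x = 0 ↔ w x < 1)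

/-- The hypothesis `h` makes the map of residue fields surjective, hence an isomorphism; `r` is the
residue map of `w` followed by its inverse, and 0 outside the valuation ring. -/
theorem exists_isResidueMap (v : Valuation K Γ₀) (w : Valuation M Γ) [v.HasExtension w]
    (h : ∀ m, w m ≤ 1 → ∃ c : K, w (m - algebraMap K M c) < 1) :
    ∃ r, IsResidueMap v w r := by
  classical
  have hlt : ∀ x : w.valuationSubring,
      IsLocalRing.residue w.valuationSubring x = 0 ↔ w (x : M) < 1 := fun x => by
    rw [IsLocalRing.residue_eq_zero_iff]
    exact Valuation.Integer.not_isUnit_iff_valuation_lt_one (v := w)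
  have hbij : Function.Bijective
      (algebraMap v.ResField w.ResField) := by
    refine ⟨RingHom.injective _, fun y => ?_⟩
    obtain ⟨⟨m, hm⟩, rfl⟩ := IsLocalRing.residue_surjective y
    obtain ⟨c, hc⟩ := h m hm
    have hc1 : v c ≤ 1 := by
      rw [← HasExtension.val_map_le_one_iff v w, ← sub_sub_cancel m (algebraMap K M c)]
      exact (w.map_sub _ _).trans (max_le hm hc.le)
    refine ⟨IsLocalRing.residue _ ⟨c, hc1⟩, ?_⟩
    rw [HasExtension.algebraMap_residue_eq_residue_algebraMap, eq_comm, ← sub_eq_zero, ← _root_.map_sub,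
      hlt]
    exact hc
  let e := RingEquiv.ofBijective _ hbij
  let res : w.valuationSubring →+* v.ResField :=
    (e.symm : w.ResField →+* v.ResField).comp (IsLocalRing.residue w.valuationSubring)
  let r : M → v.ResField := fun m => if hm : w m ≤ 1 then res ⟨m, hm⟩ else 0
  have hr : ∀ m (hm : w m ≤ 1), r m = res ⟨m, hm⟩ := fun m hm => dif_pos hm
  refine ⟨r, fun x y hx hy => ?_, fun x y hx hy => ?_, fun c => ?_, fun x hx => ?_⟩
  · rw [hr x hx, hr y hy, hr (x + y) ((w.map_add x y).trans (max_le hx hy)), ← _root_.map_add]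
    rfl
  · have hxy : w (x * y) ≤ 1 := (w.map_mul x y).trans_le (mul_le_one' hx hy)
    rw [hr x hx, hr y hy, hr (x * y) hxy, ← _root_.map_mul]
    rfl
  · rw [hr _ ((HasExtension.val_map_le_one_iff v w _).2 c.2)]
    refine e.injective ?_
    exact e.apply_symm_apply _
  · rw [hr x hx]
    refine Iff.trans ?_ (hlt ⟨x, hx⟩)
    exact e.symm.map_eq_zero_iff

namespace IsResidueMap

variable {v : Valuation K Γ₀} {w : Valuation M Γ} {r : M → v.ResField}

theorem map_zero (hr : IsResidueMap v w r) : r 0 = 0 :=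
  (hr.eq_zero_iff 0 (by simp)).2 (by simp)

theorem congr (hr : IsResidueMap v w r) {x y : M} (hx : w x ≤ 1) (hxy : w (y - x) < 1) :
    r y = r x := by
  rw [← add_sub_cancel x y, hr.map_add _ _ hx hxy.le, (hr.eq_zero_iff _ hxy.le).2 hxy, add_zero]

/-- Automorphisms act trivially on residues if every residue comes from the base field. -/
theorem map_algEquiv (hr : IsResidueMap v w r)
    (h : ∀ m, w m ≤ 1 → ∃ c : K, w (m - algebraMap K M c) < 1)
    (τ : Gal(M/K)) (hτ : ∀ m, w (τ m) = w m) {x : M} (hx : w x ≤ 1) : r (τ x) = r x := by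
  obtain ⟨c, hc⟩ := h x hx
  refine hr.congr hx ?_
  have h1 : τ x - x = τ (x - algebraMap K M c) - (x - algebraMap K M c) := by
    rw [_root_.map_sub, AlgEquiv.commutes]
    ring
  rw [h1]
  exact (w.map_sub _ _).trans_lt (max_lt (by rwa [hτ]) hc)

end IsResidueMap

end TotallyRamified

end Valuation

/-! ### Crossed products with cocycle in the base field -/

/-- A presentation of a `K`-algebra `D` as a crossed product: `D` is the direct sum of the
`M * X i`, where `X i * m = τ i m * X i` for `m ∈ M`, and `X i * X j = c i j * X (i + j)`. -/
structure CrossedProductBasis (K M D I : Type*) [Field K] [Field M] [Algebra K M] [Ring D]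
    [Algebra K D] [Fintype I] [Add I] [Zero I] where
  /-- the inclusion of the field of coefficients -/
  φ : M →ₐ[K] D
  /-- the basis -/
  X : I → D
  /-- the action of the basis elements on the coefficients -/
  τ : I → Gal(M/K)
  /-- the cocycle -/
  c : I → I → K
  /-- the coordinates -/
  repr : D ≃ₗ[K] (I → M)
  repr_symm_apply : ∀ f, repr.symm f = ∑ i, φ (f i) * X i
  X_zero : X 0 = 1
  X_mul_φ : ∀ i m, X i * φ m = φ (τ i m) * X i
  X_mul_X : ∀ i j, X i * X j = φ (algebraMap K M (c i j)) * X (i + j)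

namespace CrossedProductBasis

variable {K M D I : Type*} [Field K] [Field M] [Algebra K M] [Ring D]
    [Algebra K D] [Fintype I] [Add I] [Zero I] (b : CrossedProductBasis K M D I)

theorem sum_repr (d : D) : ∑ i, b.φ (b.repr d i) * b.X i = d := by
  rw [← b.repr_symm_apply, b.repr.symm_apply_apply]

theorem repr_sum (f : I → M) : b.repr (∑ i, b.φ (f i) * b.X i) = f := by
  rw [← b.repr_symm_apply, b.repr.apply_symm_apply]

theorem repr_φ_mul (m : M) (d : D) (i : I) : b.repr (b.φ m * d) i = m * b.repr d i := by
  have : b.φ m * d = ∑ i, b.φ (m * b.repr d i) * b.X i := by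
    conv_lhs => rw [← b.sum_repr d, Finset.mul_sum]
    simp [mul_assoc]
  rw [this, b.repr_sum]

theorem repr_mul_φ (m : M) (d : D) (i : I) :
    b.repr (d * b.φ m) i = b.repr d i * b.τ i m := by
  have : d * b.φ m = ∑ i, b.φ (b.repr d i * b.τ i m) * b.X i := by
    conv_lhs => rw [← b.sum_repr d, Finset.sum_mul]
    simp [mul_assoc, b.X_mul_φ]
  rw [this, b.repr_sum]

theorem mul_eq_sum (d e : D) : d * e = ∑ i, ∑ j,
    b.φ (b.repr d i * b.τ i (b.repr e j) * algebraMap K M (b.c i j)) * b.X (i + j) := by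
  conv_lhs => rw [← b.sum_repr d, ← b.sum_repr e, Finset.sum_mul_sum]
  refine Finset.sum_congr rfl fun i _ => Finset.sum_congr rfl fun j _ => ?_
  rw [map_mul, map_mul, mul_assoc (b.φ _ * _), ← b.X_mul_X, mul_assoc, ← mul_assoc (b.X i),
    b.X_mul_φ, mul_assoc, mul_assoc]

open Classical in
theorem repr_φ_mul_X (m : M) (i : I) : b.repr (b.φ m * b.X i) = Pi.single i m := by
  rw [← b.repr_sum (Pi.single i m), Finset.sum_eq_single i]
  · simp
  · intro j _ hj
    simp [hj]
  · simp

theorem τ_zero : b.τ 0 = 1 := by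
  classical
  refine AlgEquiv.ext fun m => ?_
  have := b.repr_φ_mul_X (b.τ 0 m) 0
  rw [← b.X_mul_φ, b.X_zero, one_mul, ← mul_one (b.φ m), ← b.X_zero, b.repr_φ_mul_X] at this
  simpa using (congrFun this 0).symm

/-- Commuting with `M` kills every coordinate with `τ i ≠ 1`, that is, all but the one at 0.
Commuting with the `X i` makes that one Galois invariant. -/
theorem isCentral [FiniteDimensional K M] [IsGalois K M] (hτ : Function.Bijective b.τ) : Algebra.IsCentral K D := by
  classical
  refine ⟨fun z hz => ?_⟩
  rw [Subalgebra.mem_center_iff] at hz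
  have h0 : ∀ i, i ≠ 0 → b.repr z i = 0 := by
    intro i hi
    by_contra hne
    refine hi (hτ.1 (Eq.trans (AlgEquiv.ext fun m => ?_) b.τ_zero.symm))
    have := congrFun (congrArg b.repr (hz (b.φ m))) i
    rw [b.repr_φ_mul, b.repr_mul_φ, mul_comm] at this
    exact (mul_left_cancel₀ hne this).symm
  have hz0 : z = b.φ (b.repr z 0) := by
    conv_lhs => rw [← b.sum_repr z]
    rw [Finset.sum_eq_single 0 (fun i _ hi => by rw [h0 i hi, map_zero, zero_mul]) (by simp),
      b.X_zero, mul_one]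
  have hfix : ∀ τ : Gal(M/K), τ (b.repr z 0) = b.repr z 0 := by
    intro τ
    obtain ⟨i, rfl⟩ := hτ.2 τ
    have := hz (b.X i)
    rw [hz0, b.X_mul_φ, ← hz0] at this
    have := congrFun (congrArg b.repr this) i
    rw [b.repr_φ_mul_X, hz0, b.repr_φ_mul_X, ← hz0] at this
    simpa using this
  obtain ⟨x, hx⟩ := (IsGalois.mem_range_algebraMap_iff_fixed _).2 hfix
  rw [Algebra.mem_bot]
  exact ⟨x, by rw [hz0, ← hx, AlgHom.commutes]⟩

/-! ### The maximum valuation of a crossed product with good reduction -/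

section Valuation

open Valuation

variable {Γ₀ Γ F : Type*} [LinearOrderedCommGroupWithZero Γ₀] [LinearOrderedCommGroupWithZero Γ]
  {v : Valuation K Γ₀} {w : Valuation M Γ} {r : M → v.ResField} [Field F] [Algebra v.ResField F]
  {β : I → F}

variable (v w r β) in
/-- The crossed product has good reduction: the reduction is the commutative twisted group algebra
over the residue field of `v` with linearly independent generators `β i` inside the field `F`. -/
structure HasGoodReduction : Prop where
  isResidueMap : IsResidueMap v w r
  valuation_τ : ∀ i m, w (b.τ i m) = w m
  valuation_c_le_one : ∀ i j, w (algebraMap K M (b.c i j)) ≤ 1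
  residue_τ : ∀ i m, w m ≤ 1 → r (b.τ i m) = r m
  exists_c : ∀ i j, ∃ c : v.valuationSubring, (c : K) = b.c i j ∧
    β i * β j = algebraMap v.ResField F (IsLocalRing.residue v.valuationSubring c) * β (i + j)
  β_zero : β 0 = 1
  linearIndependent : LinearIndependent v.ResField β

/-- The maximum of the values of the coordinates. -/
def supValue (w : Valuation M Γ) (d : D) : Γ := Finset.univ.sup fun i => w (b.repr d i)

theorem supValue_le {d : D} {g : Γ} : b.supValue w d ≤ g ↔ ∀ i, w (b.repr d i) ≤ g := by
  simp [supValue]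

theorem le_supValue (d : D) (i : I) : w (b.repr d i) ≤ b.supValue w d :=
  b.supValue_le.1 le_rfl i

theorem exists_supValue_eq (d : D) : ∃ i, b.supValue w d = w (b.repr d i) := by
  obtain ⟨i, -, hi⟩ := Finset.exists_mem_eq_sup Finset.univ ⟨0, Finset.mem_univ _⟩
    fun i => w (b.repr d i)
  exact ⟨i, hi⟩

theorem supValue_zero : b.supValue w 0 = 0 := by
  rw [← le_zero_iff, supValue_le]
  simp

theorem supValue_eq_zero_iff {d : D} : b.supValue w d = 0 ↔ d = 0 := by
  refine ⟨fun h => b.repr.map_eq_zero_iff.1 (funext fun i => ?_), fun h => h ▸ b.supValue_zero⟩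
  have := b.le_supValue (w := w) d i
  rw [h, le_zero_iff] at this
  simpa using this

theorem supValue_add (d e : D) :
    b.supValue w (d + e) ≤ max (b.supValue w d) (b.supValue w e) := by
  rw [supValue_le]
  intro i
  rw [map_add]
  exact (w.map_add _ _).trans (max_le_max (b.le_supValue d i) (b.le_supValue e i))

theorem supValue_sum_le {ι : Type*} (s : Finset ι) (f : ι → D) {g : Γ}
    (h : ∀ i ∈ s, b.supValue w (f i) ≤ g) : b.supValue w (∑ i ∈ s, f i) ≤ g := by
  rw [supValue_le]
  intro k
  rw [map_sum, Finset.sum_apply]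
  exact w.map_sum_le fun i hi => b.supValue_le.1 (h i hi) k

theorem supValue_φ_mul (m : M) (d : D) : b.supValue w (b.φ m * d) = w m * b.supValue w d := by
  refine le_antisymm (b.supValue_le.2 fun i => ?_) ?_
  · rw [b.repr_φ_mul, map_mul]
    exact mul_le_mul_right (b.le_supValue d i) _
  · obtain ⟨i, hi⟩ := b.exists_supValue_eq (w := w) d
    rw [hi, ← map_mul, ← b.repr_φ_mul]
    exact b.le_supValue _ i

theorem supValue_X (i : I) : b.supValue w (b.X i) = 1 := by
  classical
  have h : b.repr (b.X i) = Pi.single i 1 := by simpa using b.repr_φ_mul_X 1 i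
  refine le_antisymm (b.supValue_le.2 fun j => ?_) ?_
  · rw [h]
    by_cases hj : j = i
    · subst hj
      simp
    · simp [hj]
  · simpa [h] using b.le_supValue (w := w) (b.X i) i

theorem supValue_φ (m : M) : b.supValue w (b.φ m) = w m := by
  rw [← mul_one (b.φ m), ← b.X_zero, supValue_φ_mul, supValue_X, mul_one]

include b w in
theorem nontrivial : Nontrivial D := by
  refine ⟨0, 1, fun h01 => zero_ne_one (α := Γ) ?_⟩
  rw [← b.supValue_zero (w := w), h01, ← b.X_zero, supValue_X]

variable (β) in
/-- The reduction of an element. -/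
def reduction (r : M → v.ResField) (d : D) : F :=
  ∑ i, algebraMap v.ResField F (r (b.repr d i)) * β i

namespace HasGoodReduction

variable {b} (h : b.HasGoodReduction v w r β)
include h

theorem supValue_mul_φ (m : M) (d : D) : b.supValue w (d * b.φ m) = b.supValue w d * w m := by
  refine le_antisymm (b.supValue_le.2 fun i => ?_) ?_
  · rw [b.repr_mul_φ, map_mul, h.valuation_τ]
    exact mul_le_mul_left (b.le_supValue d i) _
  · obtain ⟨i, hi⟩ := b.exists_supValue_eq (w := w) d
    rw [hi, ← h.valuation_τ i m, ← map_mul, ← b.repr_mul_φ]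
    exact b.le_supValue _ i

theorem supValue_term_le (d e : D) (i j : I) : b.supValue w
    (b.φ (b.repr d i * b.τ i (b.repr e j) * algebraMap K M (b.c i j)) * b.X (i + j)) ≤
      b.supValue w d * b.supValue w e := by
  rw [supValue_φ_mul, supValue_X, mul_one, map_mul, map_mul, h.valuation_τ]
  exact mul_le_of_le_of_le_one (mul_le_mul' (b.le_supValue d i) (b.le_supValue e j))
    (h.valuation_c_le_one i j)

theorem supValue_mul_le (d e : D) : b.supValue w (d * e) ≤ b.supValue w d * b.supValue w e := by
  rw [b.mul_eq_sum d e]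
  exact b.supValue_sum_le _ _ fun i _ => b.supValue_sum_le _ _ fun j _ =>
    h.supValue_term_le d e i j

theorem reduction_zero : b.reduction β r 0 = 0 := by
  simp [reduction, h.isResidueMap.map_zero]

theorem reduction_add {d e : D} (hd : b.supValue w d ≤ 1) (he : b.supValue w e ≤ 1) :
    b.reduction β r (d + e) = b.reduction β r d + b.reduction β r e := by
  rw [supValue_le] at hd he
  simp only [reduction, ← Finset.sum_add_distrib, ← add_mul, ← map_add]
  refine Finset.sum_congr rfl fun i _ => ?_
  rw [_root_.map_add, Pi.add_apply, h.isResidueMap.map_add _ _ (hd i) (he i)]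

theorem reduction_sum {ι : Type*} (s : Finset ι) (f : ι → D)
    (hf : ∀ i ∈ s, b.supValue w (f i) ≤ 1) :
    b.reduction β r (∑ i ∈ s, f i) = ∑ i ∈ s, b.reduction β r (f i) := by
  classical
  induction s using Finset.induction_on with
  | empty => simp [h.reduction_zero]
  | insert i s hi ih =>
    rw [Finset.sum_insert hi, Finset.sum_insert hi, h.reduction_add, ih]
    · exact fun j hj => hf j (Finset.mem_insert_of_mem hj)
    · exact hf i (Finset.mem_insert_self i s)
    · exact b.supValue_sum_le _ _ fun j hj => hf j (Finset.mem_insert_of_mem hj)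

theorem reduction_φ_mul_X (m : M) (i : I) :
    b.reduction β r (b.φ m * b.X i) = algebraMap v.ResField F (r m) * β i := by
  classical
  rw [reduction, b.repr_φ_mul_X, Finset.sum_eq_single i]
  · simp
  · intro j _ hj
    simp [hj, h.isResidueMap.map_zero]
  · simp

/-- In the product of two terms, `residue_τ` removes the twist and `exists_c` identifies the residue
of the cocycle with the structure constants of the `β i`. -/
theorem reduction_mul {d e : D} (hd : b.supValue w d ≤ 1) (he : b.supValue w e ≤ 1) :
    b.reduction β r (d * e) = b.reduction β r d * b.reduction β r e := by
  have hle := fun i j => (h.supValue_term_le d e i j).trans (mul_le_one' hd he)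
  rw [b.mul_eq_sum d e, h.reduction_sum _ _ fun i _ => b.supValue_sum_le _ _ fun j _ => hle i j,
    reduction, reduction, Finset.sum_mul_sum]
  refine Finset.sum_congr rfl fun i _ => ?_
  rw [h.reduction_sum _ _ fun j _ => hle i j]
  refine Finset.sum_congr rfl fun j _ => ?_
  obtain ⟨c, hc, hβ⟩ := h.exists_c i j
  have h1 : w (b.repr d i) ≤ 1 := b.supValue_le.1 hd i
  have h2 : w (b.repr e j) ≤ 1 := b.supValue_le.1 he j
  have h3 : w (b.τ i (b.repr e j)) ≤ 1 := by rwa [h.valuation_τ]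
  rw [h.reduction_φ_mul_X, h.isResidueMap.map_mul _ _ _ (h.valuation_c_le_one i j),
    h.isResidueMap.map_mul _ _ h1 h3, h.residue_τ i _ h2, ← hc, h.isResidueMap.map_algebraMap,
    _root_.map_mul, _root_.map_mul, mul_assoc, ← hβ]
  · ring
  · rw [_root_.map_mul]
    exact mul_le_one' h1 h3

/-- Linear independence of the `β i` excludes cancellation between the residues of different
coordinates. -/
theorem reduction_eq_zero_iff {d : D} (hd : b.supValue w d ≤ 1) :
    b.reduction β r d = 0 ↔ b.supValue w d < 1 := by
  have h1 : b.reduction β r d = ∑ i, r (b.repr d i) • β i := by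
    simp [reduction, Algebra.smul_def]
  rw [h1]
  constructor
  · intro h0
    obtain ⟨i, hi⟩ := b.exists_supValue_eq (w := w) d
    rw [hi, ← h.isResidueMap.eq_zero_iff _ (b.supValue_le.1 hd i)]
    exact Fintype.linearIndependent_iff.1 h.linearIndependent _ h0 i
  · intro hlt
    refine Finset.sum_eq_zero fun i _ => ?_
    rw [(h.isResidueMap.eq_zero_iff _ (b.supValue_le.1 hd i)).2 ((b.le_supValue d i).trans_lt hlt),
      zero_smul]

/-- This is where it matters that `F` is a field: nonzero reductions have a nonzero product. -/
theorem supValue_mul_of_eq_one {d e : D} (hd : b.supValue w d = 1) (he : b.supValue w e = 1) :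
    b.supValue w (d * e) = 1 := by
  have hle : b.supValue w (d * e) ≤ 1 := by
    simpa [hd, he] using h.supValue_mul_le d e
  refine le_antisymm hle (not_lt.1 fun hlt => ?_)
  rw [← h.reduction_eq_zero_iff hle, h.reduction_mul hd.le he.le, mul_eq_zero,
    h.reduction_eq_zero_iff hd.le, h.reduction_eq_zero_iff he.le, hd, he] at hlt
  simp at hlt

theorem supValue_mul (d e : D) : b.supValue w (d * e) = b.supValue w d * b.supValue w e := by
  have hex : ∀ d : D, d ≠ 0 → ∃ m ≠ 0, b.supValue w (b.φ m⁻¹ * d) = 1 := by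
    intro d hd
    obtain ⟨i, hi⟩ := b.exists_supValue_eq (w := w) d
    have h0 : w (b.repr d i) ≠ 0 := by
      rw [← hi]
      exact b.supValue_eq_zero_iff.not.2 hd
    refine ⟨b.repr d i, by simpa using h0, ?_⟩
    rw [supValue_φ_mul, hi, map_inv₀, inv_mul_cancel₀ h0]
  by_cases hd : d = 0
  · simp [hd, supValue_zero]
  by_cases he : e = 0
  · simp [he, supValue_zero]
  obtain ⟨m, hm, hm1⟩ := hex d hd
  obtain ⟨n, hn, hn1⟩ := hex e he
  have hm' : w m ≠ 0 := by simpa using hm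
  have hn' : w n ≠ 0 := by simpa using hn
  have h1 : b.supValue w d = w m := by
    rw [supValue_φ_mul, map_inv₀, inv_mul_eq_one₀ hm'] at hm1
    exact hm1.symm
  have h2 : b.supValue w e = w n := by
    rw [supValue_φ_mul, map_inv₀, inv_mul_eq_one₀ hn'] at hn1
    exact hn1.symm
  -- The scalar `n⁻¹` that normalises `e` sits between `d` and `e`, so `d` is multiplied by `n` on
  -- the right to cancel it and by `n⁻¹ * m⁻¹` on the left to restore the value 1.
  have h3 : b.supValue w (b.φ (n⁻¹ * m⁻¹) * d * b.φ n) = 1 := by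
    rw [h.supValue_mul_φ, supValue_φ_mul, h1, map_mul, map_inv₀, map_inv₀]
    field_simp
  have h4 := h.supValue_mul_of_eq_one h3 hn1
  have h5 : b.φ n * b.φ n⁻¹ = 1 := by rw [← map_mul, mul_inv_cancel₀ hn, map_one]
  rw [mul_assoc (b.φ (n⁻¹ * m⁻¹) * d), ← mul_assoc (b.φ n), h5, one_mul, mul_assoc,
    supValue_φ_mul, map_mul, map_inv₀, map_inv₀] at h4
  rw [h1, h2]
  field_simp at h4
  rw [h4, mul_comm]

/-- The valuation of a crossed product with good reduction. -/
def valuation : Valuation D Γ where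
  toFun := b.supValue w
  map_zero' := b.supValue_zero
  map_one' := by rw [← b.X_zero, supValue_X]
  map_mul' := h.supValue_mul
  map_add_le_max' := b.supValue_add

theorem valuation_apply (d : D) : h.valuation d = b.supValue w d := rfl

theorem hasExtension [v.HasExtension w] : v.HasExtension h.valuation := by
  constructor
  have : h.valuation.comap (algebraMap K D) = w.comap (algebraMap K M) := by
    ext x
    rw [comap_apply, comap_apply, valuation_apply, ← AlgHom.commutes b.φ, supValue_φ]
  rw [this]
  exact HasExtension.val_isEquiv_comap

theorem noZeroDivisors : NoZeroDivisors D where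
  eq_zero_or_eq_zero_of_mul_eq_zero {x y} hxy := by
    rwa [← b.supValue_eq_zero_iff (w := w), h.supValue_mul, mul_eq_zero,
      b.supValue_eq_zero_iff, b.supValue_eq_zero_iff] at hxy

/-- The reduction as a ring homomorphism. -/
def reductionHom : h.valuation.integer →+* F where
  toFun d := b.reduction β r d
  map_zero' := h.reduction_zero
  map_one' := by
    have := h.reduction_φ_mul_X 1 0
    have h1 := h.isResidueMap.map_algebraMap 1
    simpa [b.X_zero, h.β_zero, show r 1 = 1 by simpa using h1] using this
  map_mul' d e := h.reduction_mul d.2 e.2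
  map_add' d e := h.reduction_add d.2 e.2

theorem reductionHom_eq_zero_iff (d : h.valuation.integer) :
    h.reductionHom d = 0 ↔ d ∈ h.valuation.integerIdeal :=
  h.reduction_eq_zero_iff d.2

theorem reductionHom_surjective [v.HasExtension w]
    (hs : ⊤ ≤ Submodule.span v.ResField (Set.range β)) :
    Function.Surjective h.reductionHom := by
  intro y
  obtain ⟨f, rfl⟩ := (Submodule.mem_span_range_iff_exists_fun _).1 (hs (Submodule.mem_top (x := y)))
  choose c hc using fun i => IsLocalRing.residue_surjective (f i)
  have hle : b.supValue w (∑ i, b.φ (algebraMap K M (c i)) * b.X i) ≤ 1 := by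
    rw [supValue_le, b.repr_sum]
    exact fun i => (HasExtension.val_map_le_one_iff v w _).2 (c i).2
  refine ⟨⟨_, hle⟩, ?_⟩
  change b.reduction β r _ = _
  rw [reduction, b.repr_sum]
  refine Finset.sum_congr rfl fun i _ => ?_
  rw [h.isResidueMap.map_algebraMap, hc, Algebra.smul_def]

/-- The residue ring of the valuation is the field generated by the `β i`. -/
theorem nonempty_residueRing_algEquiv [v.HasExtension w] [v.HasExtension h.valuation]
    (hs : ⊤ ≤ Submodule.span v.ResField (Set.range β)) :
    Nonempty (h.valuation.ResidueRing ≃ₐ[v.ResField] F) := by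
  let f : h.valuation.ResidueRing →+* F := Ideal.Quotient.lift h.valuation.integerIdeal
    h.reductionHom fun d hd => (h.reductionHom_eq_zero_iff d).2 hd
  have hf : ∀ d, f (h.valuation.toResidueRing d) = h.reductionHom d := fun d => rfl
  have hbij : Function.Bijective f := by
    constructor
    · rw [injective_iff_map_eq_zero]
      intro x hx
      obtain ⟨d, rfl⟩ := Ideal.Quotient.mk_surjective x
      exact Ideal.Quotient.eq_zero_iff_mem.2 ((h.reductionHom_eq_zero_iff d).1 hx)
    · intro y
      obtain ⟨d, rfl⟩ := h.reductionHom_surjective hs y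
      exact ⟨_, hf d⟩
  refine ⟨AlgEquiv.ofRingEquiv (f := RingEquiv.ofBijective f hbij) fun x => ?_⟩
  obtain ⟨c, rfl⟩ := IsLocalRing.residue_surjective x
  change b.reduction β r (algebraMap K D c) = _
  rw [← AlgHom.commutes b.φ, ← mul_one (b.φ _), ← b.X_zero, h.reduction_φ_mul_X, h.β_zero, mul_one,
    h.isResidueMap.map_algebraMap]

end HasGoodReduction

end Valuation

end CrossedProductBasis

/-! ### `p`-independence and adjunction of `p`-th roots -/

section PIndependent

variable {p m : ℕ} {n : Fin m → ℕ}

/-- The monomials with exponents less than `p` span, if the `p`-th powers of the generators are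
scalars. -/
theorem adjoin_le_span_monomials {k E : Type*} [CommSemiring k] [CommSemiring E] [Algebra k E]
    [NeZero p] (hn : ∀ j, n j = p) (x : Fin m → E) (c : Fin m → k)
    (hx : ∀ j, x j ^ p = algebraMap k E (c j)) :
    Subalgebra.toSubmodule (Algebra.adjoin k (Set.range x)) ≤
      Submodule.span k (Set.range fun i : ∀ j, Fin (n j) => ∏ j, x j ^ (i j).val) := by
  rw [Algebra.adjoin_eq_span, Submodule.span_le]
  intro y hy
  have hy' : ∃ e : Fin m → ℕ, y = ∏ j, x j ^ e j := by
    induction hy using Submonoid.closure_induction with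
    | mem y hy =>
      obtain ⟨j, rfl⟩ := hy
      refine ⟨Pi.single j 1, ?_⟩
      rw [Finset.prod_eq_single j]
      · simp
      · intro k _ hk
        simp [hk]
      · simp
    | one => exact ⟨0, by simp⟩
    | mul y z _ _ hy hz =>
      obtain ⟨e, rfl⟩ := hy
      obtain ⟨f, rfl⟩ := hz
      exact ⟨e + f, by simp [pow_add, Finset.prod_mul_distrib]⟩
  obtain ⟨e, rfl⟩ := hy'
  have hlt : ∀ j, e j % p < n j := fun j =>
    (Nat.mod_lt _ (NeZero.pos p)).trans_eq (hn j).symm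
  have : ∏ j, x j ^ e j = (∏ j, c j ^ (e j / p)) • ∏ j, x j ^ (e j % p) := by
    rw [Algebra.smul_def, map_prod, ← Finset.prod_mul_distrib]
    refine Finset.prod_congr rfl fun j _ => ?_
    rw [map_pow, ← hx, ← pow_mul, ← pow_add, Nat.div_add_mod]
  rw [this]
  exact Submodule.smul_mem _ _ (Submodule.subset_span ⟨fun j => ⟨_, hlt j⟩, rfl⟩)

variable [Fact p.Prime] {k : Type*} [Field k] [ExpChar k p] {b : Fin m → k}

/-- The `p ^ m` monomials span a field of degree `p ^ m`. Exponents lie in `Fin (n j)` with `n j =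
p`, to match the index type of the crossed product, where `n j` is `orderOf (σ j)`. -/
theorem IsPIndependent.linearIndependent_monomials (hb : IsPIndependent p b)
    (hn : ∀ j, n j = p) : LinearIndependent (frobenius k p).fieldRange
      (fun i : ∀ j, Fin (n j) => ∏ j, b j ^ (i j).val) := by
  classical
  let c : Fin m → (frobenius k p).fieldRange := fun j => ⟨b j ^ p, b j, frobenius_def _ _⟩
  have hc : ∀ j, b j ^ p = algebraMap _ k (c j) := fun j => rfl
  have hle := adjoin_le_span_monomials hn b c hc
  have halg : ∀ x ∈ Set.range b, IsAlgebraic (frobenius k p).fieldRange x := by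
    rintro _ ⟨j, rfl⟩
    refine IsIntegral.isAlgebraic (.of_pow (NeZero.pos p) ?_)
    rw [hc]
    exact isIntegral_algebraMap
  rw [linearIndependent_iff_card_eq_finrank_span, Set.finrank]
  have heq : Submodule.span (frobenius k p).fieldRange
      (Set.range fun i : ∀ j, Fin (n j) => ∏ j, b j ^ (i j).val) = Subalgebra.toSubmodule
      (IntermediateField.adjoin (frobenius k p).fieldRange (Set.range b)).toSubalgebra := by
    rw [IntermediateField.adjoin_toSubalgebra_of_isAlgebraic halg]
    refine le_antisymm (Submodule.span_le.2 ?_) hle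
    rintro _ ⟨i, rfl⟩
    exact Subalgebra.prod_mem _ fun j _ =>
      Subalgebra.pow_mem _ (Algebra.subset_adjoin (Set.mem_range_self j)) _
  rw [heq]
  refine Eq.trans ?_ hb.symm
  simp [hn]

variable {F : Type*} [Field F] [Algebra k F] {α : Fin m → F}

/-- Frobenius turns a relation between monomials in the `α j` over `k` into a relation between
monomials in the `b j` over the field of `p`-th powers. -/
theorem IsPIndependent.linearIndependent_roots (hb : IsPIndependent p b) (hn : ∀ j, n j = p)
    (hα : ∀ j, α j ^ p = algebraMap k F (b j)) :
    LinearIndependent k (fun i : ∀ j, Fin (n j) => ∏ j, α j ^ (i j).val) := by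
  have : ExpChar F p := expChar_of_injective_algebraMap (algebraMap k F).injective p
  rw [Fintype.linearIndependent_iff]
  intro g hg i
  have h1 := congrArg (frobenius F p) hg
  have h2 : ∑ i : ∀ j, Fin (n j), g i ^ p * ∏ j, b j ^ (i j).val = 0 := by
    refine (algebraMap k F).injective ?_
    rw [map_zero] at h1 ⊢
    rw [← h1, map_sum, map_sum]
    refine Finset.sum_congr rfl fun i _ => ?_
    rw [Algebra.smul_def, frobenius_def, mul_pow, ← Finset.prod_pow, map_mul, map_pow, map_prod]
    congr 1
    refine Finset.prod_congr rfl fun j _ => ?_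
    rw [map_pow, ← hα, pow_right_comm]
  have h3 := Fintype.linearIndependent_iff.1 (hb.linearIndependent_monomials hn)
    (fun i => ⟨g i ^ p, g i, frobenius_def _ _⟩) h2 i
  exact eq_zero_of_pow_eq_zero (congrArg Subtype.val h3)

theorem span_roots_eq_top [Polynomial.IsSplittingField k F (∏ j, (Polynomial.X ^ p - Polynomial.C (b j)))]
    (hn : ∀ j, n j = p) (hα : ∀ j, α j ^ p = algebraMap k F (b j)) :
    ⊤ ≤ Submodule.span k (Set.range fun i : ∀ j, Fin (n j) => ∏ j, α j ^ (i j).val) := by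
  have : ExpChar F p := expChar_of_injective_algebraMap (algebraMap k F).injective p
  refine le_trans ?_ (adjoin_le_span_monomials hn α b hα)
  rw [← Algebra.top_toSubmodule, ← Polynomial.IsSplittingField.adjoin_rootSet F
    (∏ j, (Polynomial.X ^ p - Polynomial.C (b j)))]
  refine Algebra.adjoin_mono fun y hy => ?_
  have := Polynomial.aeval_eq_zero_of_mem_rootSet hy
  rw [map_prod, Finset.prod_eq_zero_iff] at this
  obtain ⟨j, -, hj⟩ := this
  -- A `p`-th root is unique in characteristic exponent `p`, so the only roots of the polynomial are
  -- the `α j`.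
  refine ⟨j, frobenius_inj F p ?_⟩
  rw [frobenius_def, frobenius_def, hα]
  rw [map_sub, map_pow, Polynomial.aeval_X, Polynomial.aeval_C, sub_eq_zero] at hj
  exact hj.symm

theorem exists_roots (p : ℕ) [Fact p.Prime] (b : Fin m → k)
    [Polynomial.IsSplittingField k F (∏ j, (Polynomial.X ^ p - Polynomial.C (b j)))] :
    ∃ α : Fin m → F, ∀ j, α j ^ p = algebraMap k F (b j) := by
  have hp : p ≠ 0 := (Fact.out : p.Prime).ne_zero
  have hne : ∀ j, (Polynomial.X ^ p - Polynomial.C (b j)) ≠ 0 := fun j =>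
    Polynomial.X_pow_sub_C_ne_zero (Nat.pos_of_ne_zero hp) _
  have hs := Polynomial.IsSplittingField.splits F
    (∏ j, (Polynomial.X ^ p - Polynomial.C (b j)))
  have : ∀ j, ∃ x : F, x ^ p = algebraMap k F (b j) := by
    intro j
    have hj : ((Polynomial.X ^ p - Polynomial.C (b j)).map (algebraMap k F)).Splits := by
      refine hs.of_dvd ?_ (Polynomial.map_dvd _ (Finset.dvd_prod_of_mem _ (Finset.mem_univ j)))
      rw [Polynomial.map_ne_zero_iff (algebraMap k F).injective]
      exact Finset.prod_ne_zero_iff.2 fun j _ => hne j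
    obtain ⟨x, hx⟩ := hj.exists_eval_eq_zero (by
      rw [Polynomial.degree_map, Polynomial.degree_X_pow_sub_C (Nat.pos_of_ne_zero hp)]
      exact_mod_cast hp)
    exact ⟨x, by simpa [sub_eq_zero] using hx⟩
  choose α hα using this
  exact ⟨α, hα⟩

end PIndependent

/-! ### Tensor products of cyclic algebras as crossed products -/

theorem PiTensorProduct.finrank_eq_prod {K ι : Type*} [Field K] [Fintype ι] (V : ι → Type*)
    [∀ i, AddCommGroup (V i)] [∀ i, Module K (V i)] [∀ i, FiniteDimensional K (V i)] :
    Module.finrank K (⨂[K] i, V i) = ∏ i, Module.finrank K (V i) := by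
  classical
  rw [Module.finrank_eq_card_basis (Basis.piTensorProduct fun i => Module.finBasis K (V i))]
  simp

theorem PiTensorProduct.liftAlgHom_tprod {R ι S : Type*} {A : ι → Type*} [CommSemiring R]
    [∀ i, Semiring (A i)] [∀ i, Algebra R (A i)] [Semiring S] [Algebra R S]
    (f : MultilinearMap R A S) (one : f 1 = 1) (mul : ∀ x y, f (x * y) = f x * f y) (x : ∀ i, A i) :
    liftAlgHom f one mul (PiTensorProduct.tprod R x) = f x :=
  lift.tprod x

instance PiTensorProduct.isScalarTower_self {R ι : Type*} {A : ι → Type*} [CommSemiring R]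
    [∀ i, Semiring (A i)] [∀ i, Algebra R (A i)] :
    IsScalarTower R (⨂[R] i, A i) (⨂[R] i, A i) :=
  IsScalarTower.right (R := R) (A := ⨂[R] i, A i)

instance PiTensorProduct.smulCommClass_self {R ι : Type*} {A : ι → Type*} [CommSemiring R]
    [∀ i, Semiring (A i)] [∀ i, Algebra R (A i)] :
    SMulCommClass R (⨂[R] i, A i) (⨂[R] i, A i) :=
  Algebra.to_smulCommClass (R := R) (A := ⨂[R] i, A i)

namespace CyclicAlgebra

variable {K L : Type*} [Field K] [Field L] [Algebra K L] {σ : Gal(L/K)} {a : K}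

theorem finrank_eq [FiniteDimensional K L] :
    Module.finrank K (CyclicAlgebra σ a) = orderOf σ * Module.finrank K L := by
  let e : CyclicAlgebra σ a ≃ₗ[K] (Fin (orderOf σ) → L) := (equivFun σ a).linearEquiv K
  rw [e.finrank_eq, Module.finrank_pi_fintype]
  simp

instance [FiniteDimensional K L] : FiniteDimensional K (CyclicAlgebra σ a) :=
  Module.Finite.equiv ((equivFun σ a).linearEquiv K).symm

variable [FiniteDimensional K L]

variable (σ a) in
/-- The inclusion of the coefficient field. -/
def incl : L →ₐ[K] CyclicAlgebra σ a :=
  AlgHom.ofLinearMap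
    { toFun := monomial a 0
      map_add' := map_add _
      map_smul' := fun c l => (smul_monomial c 0 l).symm }
    rfl (fun l m => by simp [monomial_mul_monomial, carry, orderOf_pos σ])

theorem incl_apply (l : L) : incl σ a l = monomial a 0 l := rfl

theorem incl_mul_monomial (l m : L) (i : Fin (orderOf σ)) :
    incl σ a l * monomial a i m = monomial a i (l * m) := by
  simp [incl_apply, monomial_mul_monomial, carry]

theorem monomial_mul_incl (l m : L) (i : Fin (orderOf σ)) :
    monomial a i l * incl σ a m = monomial a i (l * (σ ^ i.val) m) := by
  simp [incl_apply, monomial_mul_monomial, carry]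

end CyclicAlgebra

section Compositum

variable {K M ι : Type*} [Field K] [Field M] [Algebra K M] [FiniteDimensional K M] [Fintype ι]
  (L : ι → IntermediateField K M)

/-- The algebra homomorphism `⨂ L j → M` which is `f j` on each factor. -/
def tensorLift (f : ∀ j, L j →ₐ[K] M) : (⨂[K] j, L j) →ₐ[K] M :=
  PiTensorProduct.liftAlgHom ((MultilinearMap.mkPiAlgebra K ι M).compLinearMap fun j => (f j).toLinearMap)
    (by simp) (fun x y => by simp [Finset.prod_mul_distrib])

omit [FiniteDimensional K M] in
theorem tensorLift_tprod (f : ∀ j, L j →ₐ[K] M) (l : ∀ j, L j) :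
    tensorLift L f (PiTensorProduct.tprod K l) = ∏ j, f j (l j) :=
  (PiTensorProduct.liftAlgHom_tprod _ _ _ l).trans rfl

/-- The image is a subalgebra of an algebraic extension, hence a field; it contains every `L j`,
hence is `M`. Equality of dimensions then gives injectivity. -/
theorem tensorLift_val_bijective (hLM : ⨆ j, L j = ⊤)
    (hdim : ∏ j, Module.finrank K (L j) = Module.finrank K M) :
    Function.Bijective (tensorLift L fun j => (L j).val) := by
  classical
  have hs : Function.Surjective (tensorLift L fun j => (L j).val) := by
    rw [← AlgHom.range_eq_top]
    have hle : ⨆ j, L j ≤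
        Subalgebra.IsAlgebraic.toIntermediateField (S := (tensorLift L fun j => (L j).val).range)
          fun x _ => Algebra.IsAlgebraic.isAlgebraic x := by
      refine iSup_le fun j x hx => ⟨PiTensorProduct.singleAlgHom j ⟨x, hx⟩, ?_⟩
      rw [PiTensorProduct.singleAlgHom_apply]
      refine (tensorLift_tprod L _ _).trans ?_
      rw [Finset.prod_eq_single j]
      · simp
      · intro k _ hk
        simp [hk]
      · simp
    rw [hLM] at hle
    exact top_le_iff.1 fun x hx => hle (IntermediateField.mem_top (x := x))
  have hfin : Module.finrank K (⨂[K] j, L j) = Module.finrank K M := by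
    rw [PiTensorProduct.finrank_eq_prod, hdim]
  exact ⟨(LinearMap.injective_iff_surjective_of_finrank_eq_finrank hfin
    (f := (tensorLift L fun j => (L j).val).toLinearMap)).2 hs, hs⟩

variable (hbij : Function.Bijective (tensorLift L fun j => (L j).val))

/-- The identification of `M` with the tensor product of the `L j`. -/
def tensorEquiv : (⨂[K] j, L j) ≃ₐ[K] M := AlgEquiv.ofBijective _ hbij

omit [FiniteDimensional K M] in
theorem tensorEquiv_symm_prod (l : ∀ j, L j) :
    (tensorEquiv L hbij).symm (∏ j, (l j : M)) = PiTensorProduct.tprod K l := by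
  rw [AlgEquiv.symm_apply_eq]
  exact (tensorLift_tprod L (fun j => (L j).val) l).symm

-- The products `∏ j, l j` are the images of the pure tensors, so they span `M`; linear identities
-- on `M` can be checked factor by factor.
omit [FiniteDimensional K M] in
include hbij in
theorem linearMap_ext_prod {V : Type*} [AddCommGroup V] [Module K V] {f g : M →ₗ[K] V}
    (h : ∀ l : ∀ j, L j, f (∏ j, (l j : M)) = g (∏ j, (l j : M))) : f = g := by
  have : f ∘ₗ (tensorEquiv L hbij).toLinearMap = g ∘ₗ (tensorEquiv L hbij).toLinearMap := by
    refine PiTensorProduct.ext (MultilinearMap.ext fun l => ?_)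
    have h1 : tensorEquiv L hbij (PiTensorProduct.tprod K l) = ∏ j, (l j : M) := tensorLift_tprod L (fun j => (L j).val) l
    simpa [h1] using h l
  refine LinearMap.ext fun m => ?_
  simpa using LinearMap.congr_fun this ((tensorEquiv L hbij).symm m)

/-- The automorphism of `M` which is `τ j` on each factor. -/
def compositumGal (τ : ∀ j, Gal(L j/K)) : Gal(M/K) :=
  AlgEquiv.ofBijective ((tensorLift L fun j => (L j).val.comp (τ j : L j →ₐ[K] L j)).comp
    ((tensorEquiv L hbij).symm : M →ₐ[K] ⨂[K] j, L j)) (Algebra.IsAlgebraic.algHom_bijective _)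

theorem compositumGal_prod (τ : ∀ j, Gal(L j/K)) (l : ∀ j, L j) :
    compositumGal L hbij τ (∏ j, (l j : M)) = ∏ j, (τ j (l j) : M) := by
  change tensorLift L _ ((tensorEquiv L hbij).symm _) = _
  rw [tensorEquiv_symm_prod, tensorLift_tprod]
  rfl

theorem compositumGal_injective : Function.Injective (compositumGal L hbij) := by
  classical
  intro τ τ' h
  refine funext fun j => AlgEquiv.ext fun x => Subtype.ext ?_
  have hprod : ∀ τ : ∀ j, Gal(L j/K), compositumGal L hbij τ (x : M) = τ j x := by
    intro τ
    have h1 : ∏ k, ((Pi.mulSingle j x : ∀ k, L k) k : M) = x := by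
      rw [Finset.prod_eq_single j]
      · simp
      · intro k _ hk
        simp [hk]
      · simp
    conv_lhs => rw [← h1]
    rw [compositumGal_prod, Finset.prod_eq_single j]
    · simp
    · intro k _ hk
      simp [hk]
    · simp
  rw [← hprod, ← hprod, h]

variable (σ : ∀ j, Gal(L j/K)) (a : ι → K)

/-- The inclusion of the compositum in the tensor product of cyclic algebras. -/
def compositumIncl : M →ₐ[K] ⨂[K] j, CyclicAlgebra (σ j) (a j) :=
  (PiTensorProduct.liftAlgHom ((PiTensorProduct.tprod K).compLinearMap fun j => (CyclicAlgebra.incl (σ j) (a j)).toLinearMap)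
    (by simp [PiTensorProduct.one_def, Pi.one_def]) (fun x y => by simp [Pi.mul_def])).comp
    ((tensorEquiv L hbij).symm : M →ₐ[K] ⨂[K] j, L j)

theorem compositumIncl_prod (l : ∀ j, L j) :
    compositumIncl L hbij σ a (∏ j, (l j : M)) =
      PiTensorProduct.tprod K fun j => CyclicAlgebra.incl (σ j) (a j) (l j) := by
  rw [compositumIncl, AlgHom.comp_apply, AlgEquiv.coe_toAlgHom, tensorEquiv_symm_prod]
  exact PiTensorProduct.liftAlgHom_tprod _ _ _ l

/-- The products of powers of the canonical generators of the cyclic algebras. -/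
def tensorMonomial (i : ∀ j, Fin (orderOf (σ j))) : ⨂[K] j, CyclicAlgebra (σ j) (a j) :=
  PiTensorProduct.tprod K fun j => CyclicAlgebra.monomial (a j) (i j) 1

theorem compositumIncl_prod_mul_tensorMonomial (l : ∀ j, L j) (i : ∀ j, Fin (orderOf (σ j))) :
    compositumIncl L hbij σ a (∏ j, (l j : M)) * tensorMonomial L σ a i =
      PiTensorProduct.tprod K fun j => CyclicAlgebra.monomial (a j) (i j) (l j) := by
  rw [compositumIncl_prod, tensorMonomial, PiTensorProduct.tprod_mul_tprod]
  congr 1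
  funext j
  simp [CyclicAlgebra.incl_mul_monomial]

theorem tensorMonomial_mul_compositumIncl (i : ∀ j, Fin (orderOf (σ j))) (m : M) :
    tensorMonomial L σ a i * compositumIncl L hbij σ a m =
      compositumIncl L hbij σ a (compositumGal L hbij (fun j => σ j ^ (i j).val) m) *
        tensorMonomial L σ a i := by
  refine LinearMap.congr_fun (f := LinearMap.mulLeft K (tensorMonomial L σ a i) ∘ₗ
    (compositumIncl L hbij σ a).toLinearMap) (g := LinearMap.mulRight K (tensorMonomial L σ a i) ∘ₗ
    (compositumIncl L hbij σ a).toLinearMap ∘ₗ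
    (compositumGal L hbij (fun j => σ j ^ (i j).val)).toLinearMap)
    (linearMap_ext_prod L hbij fun l => ?_) m
  change tensorMonomial L σ a i * compositumIncl L hbij σ a _ =
    compositumIncl L hbij σ a (compositumGal L hbij _ _) * tensorMonomial L σ a i
  rw [compositumGal_prod, compositumIncl_prod_mul_tensorMonomial, compositumIncl_prod, tensorMonomial,
    PiTensorProduct.tprod_mul_tprod]
  congr 1
  funext j
  simp [CyclicAlgebra.monomial_mul_incl]

/-- The cocycle of a tensor product of cyclic algebras. -/
def tensorCarry (i i' : ∀ j, Fin (orderOf (σ j))) : K :=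
  ∏ j, if (i j).val + (i' j).val < orderOf (σ j) then 1 else a j

/-- Each factor contributes a carry 1 or `a j`, so the cocycle lies in `K`. -/
theorem tensorMonomial_mul_tensorMonomial (i i' : ∀ j, Fin (orderOf (σ j))) :
    tensorMonomial L σ a i * tensorMonomial L σ a i' =
      compositumIncl L hbij σ a (algebraMap K M (tensorCarry L σ a i i')) *
        tensorMonomial L σ a (i + i') := by
  have h : algebraMap K M (tensorCarry L σ a i i') =
      ∏ j, ((CyclicAlgebra.carry (L := L j) (a j) (i j) (i' j) : L j) : M) := by
    rw [tensorCarry, map_prod]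
    refine Finset.prod_congr rfl fun j _ => ?_
    rw [CyclicAlgebra.carry]
    split_ifs
    · simp
    · rfl
  rw [h, compositumIncl_prod_mul_tensorMonomial, tensorMonomial, tensorMonomial, PiTensorProduct.tprod_mul_tprod]
  congr 1
  funext j
  simp [CyclicAlgebra.monomial_mul_monomial]

variable [DecidableEq ι]

/-- The linear combinations of the monomials with coefficients in the compositum. -/
def tensorSum : ((∀ j, Fin (orderOf (σ j))) → M) →ₗ[K] ⨂[K] j, CyclicAlgebra (σ j) (a j) where
  toFun f := ∑ i, compositumIncl L hbij σ a (f i) * tensorMonomial L σ a i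
  map_add' f g := by simp [add_mul, Finset.sum_add_distrib]
  map_smul' c f := by simp [Finset.smul_sum, smul_mul_assoc]

theorem tensorSum_surjective : Function.Surjective (tensorSum L hbij σ a) := by
  rw [← LinearMap.range_eq_top, ← top_le_iff]
  rintro x -
  induction x using PiTensorProduct.induction_on with
  | smul_tprod c f =>
    refine Submodule.smul_mem _ _ ?_
    have hf : f = fun j => ∑ i, CyclicAlgebra.monomial (a j) i ((f j).coeff i) :=
      funext fun j => (CyclicAlgebra.sum_monomial (f j)).symm
    rw [hf, MultilinearMap.map_sum]
    refine Submodule.sum_mem _ fun i _ => ?_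
    rw [← compositumIncl_prod_mul_tensorMonomial L hbij σ a (fun j => (f j).coeff (i j)) i]
    refine ⟨Pi.single i (∏ j, ((f j).coeff (i j) : M)), ?_⟩
    change ∑ _, _ = _
    rw [Finset.sum_eq_single i]
    · simp
    · intro k _ hk
      simp [hk]
    · simp
  | add x y hx hy => exact Submodule.add_mem _ hx hy

/-- Both sides have dimension `[M : K] * ∏ orderOf (σ j)`, so surjectivity suffices. -/
theorem tensorSum_bijective (hdim : ∏ j, Module.finrank K (L j) = Module.finrank K M) :
    Function.Bijective (tensorSum L hbij σ a) := by
  have hs := tensorSum_surjective L hbij σ a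
  have hfin : Module.finrank K ((∀ j, Fin (orderOf (σ j))) → M) =
      Module.finrank K (⨂[K] j, CyclicAlgebra (σ j) (a j)) := by
    rw [PiTensorProduct.finrank_eq_prod, Module.finrank_pi_fintype]
    simp [CyclicAlgebra.finrank_eq, Finset.prod_mul_distrib, hdim]
  exact ⟨(LinearMap.injective_iff_surjective_of_finrank_eq_finrank hfin).2 hs, hs⟩

/-- A tensor product of cyclic algebras over linearly disjoint fields as a crossed product. -/
def tensorCrossedProductBasis
    (hdim : ∏ j, Module.finrank K (L j) = Module.finrank K M) :
    CrossedProductBasis K M (⨂[K] j, CyclicAlgebra (σ j) (a j)) (∀ j, Fin (orderOf (σ j))) where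
  φ := compositumIncl L hbij σ a
  X := tensorMonomial L σ a
  τ i := compositumGal L hbij fun j => σ j ^ (i j).val
  c := tensorCarry L σ a
  repr := (LinearEquiv.ofBijective _ (tensorSum_bijective L hbij σ a hdim)).symm
  repr_symm_apply _ := rfl
  X_zero := rfl
  X_mul_φ := tensorMonomial_mul_compositumIncl L hbij σ a
  X_mul_X := tensorMonomial_mul_tensorMonomial L hbij σ a

end Compositum

/-! ### Uniqueness of the extension of a Henselian valuation -/

namespace Valuation

section Uniqueness

variable {K D : Type u} [Field K] [Ring D] [Algebra K D]
  {Γ₀ Γ Γ' : Type*} [LinearOrderedCommGroupWithZero Γ₀] [LinearOrderedCommGroupWithZero Γ]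
  [LinearOrderedCommGroupWithZero Γ'] {v : Valuation K Γ₀}

/-- Restriction to a commutative field `E` mapping to `D`, put in the form of valuation subrings in
which `IsHenselian` is stated. -/
theorem hasExtension_valuationSubring_comap {E : Type*} [Field E] [Algebra K E]
    (w : Valuation D Γ) [v.HasExtension w] (f : E →+* D)
    (hf : f.comp (algebraMap K E) = algebraMap K D) :
    v.HasExtension (w.comap f).valuationSubring.valuation := by
  constructor
  have h : v.IsEquiv ((w.comap f).comap (algebraMap K E)) := by
    rw [← comap_comp, hf]
    exact HasExtension.val_isEquiv_comap
  exact h.trans ((isEquiv_valuation_valuationSubring _).comap _)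

theorem map_le_map_unit_iff (w : Valuation D Γ) (x : D) (y : Dˣ) :
    w x ≤ w y ↔ w (x * ↑y⁻¹) ≤ 1 := by
  have hy : w (y : D) * w (↑y⁻¹ : D) = 1 := by rw [← map_mul, y.mul_inv, map_one]
  rw [map_mul, eq_inv_of_mul_eq_one_right hy, ← div_eq_mul_inv,
    div_le_one₀ (zero_lt_iff.2 (left_ne_zero_of_mul_eq_one hy))]

variable [IsDomain D] [FiniteDimensional K D]

/-- As `D` is a domain, the minimal polynomial of `x` is irreducible and `K[x]` is a finite field
extension of `K`. Both valuations restrict to it as extensions of `v`, so they have the same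
valuation ring there. -/
theorem IsHenselian.map_le_one_iff (hv : v.IsHenselian) (w : Valuation D Γ) (w' : Valuation D Γ')
    [v.HasExtension w] [v.HasExtension w'] (x : D) : w x ≤ 1 ↔ w' x ≤ 1 := by
  have hx : IsIntegral K x := Algebra.IsIntegral.isIntegral x
  have hirr : Fact (Irreducible (minpoly K x)) := ⟨minpoly.irreducible hx⟩
  have hfin : FiniteDimensional K (AdjoinRoot (minpoly K x)) :=
    (AdjoinRoot.powerBasis (minpoly.ne_zero hx)).finite
  let f : AdjoinRoot (minpoly K x) →+* D := Ideal.Quotient.lift (Ideal.span {minpoly K x})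
    (Polynomial.aeval x : K[X] →ₐ[K] D).toRingHom (by
      intro q hq
      obtain ⟨s, rfl⟩ := Ideal.mem_span_singleton'.1 hq
      simp)
  have hfx : f (AdjoinRoot.root _) = x := Polynomial.aeval_X x
  have hfK : f.comp (algebraMap K (AdjoinRoot (minpoly K x))) = algebraMap K D :=
    RingHom.ext fun c => Polynomial.aeval_C x c
  have heq := (hv (AdjoinRoot (minpoly K x))).unique
    (hasExtension_valuationSubring_comap w f hfK) (hasExtension_valuationSubring_comap w' f hfK)
  have := SetLike.ext_iff.1 heq (AdjoinRoot.root _)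
  rwa [mem_valuationSubring_iff, mem_valuationSubring_iff, comap_apply, comap_apply, hfx] at this

/-- A Henselian valuation has at most one extension to a division algebra. -/
theorem IsHenselian.isEquiv_of_hasExtension (hv : v.IsHenselian) (w : Valuation D Γ)
    (w' : Valuation D Γ') [v.HasExtension w] [v.HasExtension w'] : w.IsEquiv w' := by
  have h (x : D) (y : Dˣ) : w x ≤ w y ↔ w' x ≤ w' y := by
    rw [map_le_map_unit_iff, map_le_map_unit_iff, hv.map_le_one_iff w w']
  intro x y
  by_cases hy : y = 0
  · subst hy
    by_cases hx : x = 0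
    · simp [hx]
    · have h0 := (FiniteDimensional.isUnit K hx).map w
      have h0' := (FiniteDimensional.isUnit K hx).map w'
      simp [h0.ne_zero, h0'.ne_zero]
  · exact h x (FiniteDimensional.isUnit K hy).unit

end Uniqueness

end Valuation

/-! ### Good reduction of the tensor product, and the theorem -/

section Main

open Valuation

variable {K M F : Type*} [Field K] [Field M] [Algebra K M] [FiniteDimensional K M]
  {Γ₀ Γ : Type*} [LinearOrderedCommGroupWithZero Γ₀] [LinearOrderedCommGroupWithZero Γ]
  {v : Valuation K Γ₀} {w : Valuation M Γ} [v.HasExtension w] {μ p : ℕ}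
  (L : Fin μ → IntermediateField K M)
  (hbij : Function.Bijective (tensorLift L fun j => (L j).val))
  (σ : ∀ j, Gal(L j/K)) (a : Fin μ → v.valuationSubring)
  (hdim : ∏ j, Module.finrank K (L j) = Module.finrank K M)

-- When exponents add up to `p` or more, the generator `x_j` sheds a factor `a j` and the root `α j`
-- sheds `α j ^ p`, the residue of `a j`; the two carries correspond.
omit [FiniteDimensional K M] in
theorem exists_tensorCarry [Field F] [Algebra v.ResField F] (hσ : ∀ j, orderOf (σ j) = p)
    {α : Fin μ → F}
    (hα : ∀ j, α j ^ p = algebraMap v.ResField F (IsLocalRing.residue v.valuationSubring (a j)))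
    (i i' : ∀ j, Fin (orderOf (σ j))) :
    ∃ c : v.valuationSubring, (c : K) = tensorCarry L σ (fun j => (a j : K)) i i' ∧
      (∏ j, α j ^ (i j).val) * ∏ j, α j ^ (i' j).val =
        algebraMap v.ResField F (IsLocalRing.residue v.valuationSubring c) *
          ∏ j, α j ^ ((i + i') j).val := by
  refine ⟨∏ j, if (i j).val + (i' j).val < orderOf (σ j) then 1 else a j, ?_, ?_⟩
  · rw [tensorCarry, ← ValuationSubring.subtype_apply, map_prod]
    refine Finset.prod_congr rfl fun j _ => ?_
    split_ifs <;> simp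
  · rw [← Finset.prod_mul_distrib, map_prod, map_prod, ← Finset.prod_mul_distrib]
    refine Finset.prod_congr rfl fun j _ => ?_
    have h1 := (i j).2
    have h2 := (i' j).2
    rw [Pi.add_apply, Fin.val_add, ← pow_add]
    split_ifs with h
    · rw [Nat.mod_eq_of_lt h, map_one, map_one, one_mul]
    · rw [Nat.mod_eq_sub_mod (by omega), Nat.mod_eq_of_lt (by omega), ← hα, ← hσ j, ← pow_add]
      congr 1
      omega

theorem tensorCrossedProductBasis_hasGoodReduction [Fact p.Prime] [ExpChar v.ResField p]
    {r : M → v.ResField} (hr : IsResidueMap v w r)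
    (hw : ∀ m, w m ≤ 1 → ∃ c : K, w (m - algebraMap K M c) < 1)
    (hτ : ∀ (τ : Gal(M/K)) (m : M), w (τ m) = w m)
    (hσ : ∀ j, orderOf (σ j) = p)
    (ha : IsPIndependent p fun j => IsLocalRing.residue v.valuationSubring (a j))
    [Field F] [Algebra v.ResField F] {α : Fin μ → F}
    (hα : ∀ j, α j ^ p = algebraMap v.ResField F (IsLocalRing.residue v.valuationSubring (a j))) :
    (tensorCrossedProductBasis L hbij σ (fun j => (a j : K)) hdim).HasGoodReduction v w r
      (fun i => ∏ j, α j ^ (i j).val) where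
  isResidueMap := hr
  valuation_τ _ := hτ _
  valuation_c_le_one i i' := by
    obtain ⟨c, hc, -⟩ := exists_tensorCarry L σ a hσ hα i i'
    change w (algebraMap K M (tensorCarry L σ _ i i')) ≤ 1
    rw [← hc]
    exact (HasExtension.val_map_le_one_iff v w _).2 c.2
  residue_τ _ _ hm := hr.map_algEquiv hw _ (hτ _) hm
  exists_c := exists_tensorCarry L σ a hσ hα
  β_zero := by simp
  linearIndependent := ha.linearIndependent_roots hσ hα

/-- Injectivity is seen on each `L j`, where exponents below the order of `σ j` are determined by
the power; both sets have `p ^ μ` elements. -/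
theorem compositumGal_pow_bijective [IsGalois K M] (hσ : ∀ j, orderOf (σ j) = p)
    (hcard : Nat.card Gal(M/K) = p ^ μ) :
    Function.Bijective fun i : ∀ j, Fin (orderOf (σ j)) =>
      compositumGal L hbij fun j => σ j ^ (i j).val := by
  have : Fintype Gal(M/K) := Fintype.ofFinite _
  rw [Fintype.bijective_iff_injective_and_card]
  constructor
  · intro i i' h
    have h1 := compositumGal_injective L hbij h
    exact funext fun j => Fin.ext (pow_injOn_Iio_orderOf (i j).2 (i' j).2 (congrFun h1 j))
  · rw [← Nat.card_eq_fintype_card (α := Gal(M/K)), hcard]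
    simp [hσ]

end Main

end

theorem mainTheorem3 {K : Type u} [Field K] {Γ₀ : Type*} [LinearOrderedCommGroupWithZero Γ₀]
    (v : Valuation K Γ₀) [v.IsRankOneDiscrete] (hv : v.IsHenselian)
    (p : ℕ) [Fact p.Prime] [CharP v.ResField p]
    {M : Type u} [Field M] [Algebra K M] [FiniteDimensional K M] [IsAbelianGalois K M]
    (hM : v.IsTotallyRamified M) (μ : ℕ)
    (hexp : Monoid.exponent Gal(M/K) = p) (hcard : Nat.card Gal(M/K) = p ^ μ)
    (L : Fin μ → IntermediateField K M) (hL : ∀ j, Module.finrank K (L j) = p)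
    (hLM : ⨆ j, L j = ⊤)
    (σ : ∀ j, Gal(L j/K)) (hσ : ∀ j, ∀ τ : Gal(L j/K), τ ∈ Subgroup.zpowers (σ j))
    (a : Fin μ → v.valuationSubringˣ)
    (ha : IsPIndependent p fun j => IsLocalRing.residue v.valuationSubring (a j)) :
    IsCentralDivisionAlgebra K (⨂[K] j, CyclicAlgebra (σ j) ((a j : v.valuationSubring) : K)) ∧
    ∃ (Γ : Type u) (_ : LinearOrderedCommGroupWithZero Γ)
      (w : Valuation (⨂[K] j, CyclicAlgebra (σ j) ((a j : v.valuationSubring) : K)) Γ)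
      (_ : v.HasExtension w),
      (∀ (Γ' : Type u) [LinearOrderedCommGroupWithZero Γ']
        (w' : Valuation (⨂[K] j, CyclicAlgebra (σ j) ((a j : v.valuationSubring) : K)) Γ'),
        v.HasExtension w' → w.IsEquiv w') ∧
      Nonempty (w.ResidueRing ≃ₐ[v.ResField] (∏ j, (Polynomial.X ^ p - Polynomial.C
        (IsLocalRing.residue v.valuationSubring (a j))) : v.ResField[X]).SplittingField) ∧
      Module.finrank v.ResField w.ResidueRing = p ^ μ := by
  obtain ⟨W, hW, huniq, hidx⟩ := hM
  have hdim : ∏ j, Module.finrank K (L j) = Module.finrank K M := by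
    rw [← IsGalois.card_aut_eq_finrank K M, hcard]
    simp [hL]
  have hσ' : ∀ j, orderOf (σ j) = p := fun j => by
    rw [orderOf_eq_card_of_forall_mem_zpowers (hσ j), IsGalois.card_aut_eq_finrank, hL]
  have hbij := tensorLift_val_bijective L hLM hdim
  have hres : ∀ m, W.valuation m ≤ 1 → ∃ c : K, W.valuation (m - algebraMap K M c) < 1 :=
    fun m hm => Valuation.exists_map_sub_algebraMap_lt_one W.valuation hidx hm
  obtain ⟨r, hr⟩ := Valuation.exists_isResidueMap v W.valuation hres
  obtain ⟨α, hα⟩ := exists_roots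
    (F := (∏ j, (Polynomial.X ^ p - Polynomial.C
      (IsLocalRing.residue v.valuationSubring (a j))) : v.ResField[X]).SplittingField) p
    fun j => IsLocalRing.residue v.valuationSubring (a j : v.valuationSubring)
  have hgood := tensorCrossedProductBasis_hasGoodReduction L hbij σ
    (fun j => (a j : v.valuationSubring)) hdim hr hres
    (Valuation.map_algEquiv_eq v W huniq) hσ' ha hα
  have hspan := span_roots_eq_top hσ' hα
  have hfin : FiniteDimensional K
      (⨂[K] j, CyclicAlgebra (σ j) ((a j : v.valuationSubring) : K)) := inferInstance
  have hnt := (tensorCrossedProductBasis L hbij σ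
    (fun j => ((a j : v.valuationSubring) : K)) hdim).nontrivial (w := W.valuation)
  have hnz := hgood.noZeroDivisors
  -- A finite-dimensional algebra that is a domain is a division algebra; this gives the inverses
  -- below and is needed for uniqueness.
  have hdom : IsDomain (⨂[K] j, CyclicAlgebra (σ j) ((a j : v.valuationSubring) : K)) :=
    NoZeroDivisors.to_isDomain _
  have hext := hgood.hasExtension
  obtain ⟨e⟩ := hgood.nonempty_residueRing_algEquiv hspan
  refine ⟨⟨hfin, (tensorCrossedProductBasis L hbij σ _ hdim).isCentral
    (compositumGal_pow_bijective L hbij σ hσ' hcard), hnt, fun x hx =>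
      FiniteDimensional.isUnit K hx⟩, W.ValueGroup, inferInstance, hgood.valuation, hext,
    fun Γ' _ w' hw' => hv.isEquiv_of_hasExtension _ _, ⟨e⟩, ?_⟩
  rw [e.toLinearEquiv.finrank_eq,
    Module.finrank_eq_card_basis (Module.Basis.mk hgood.linearIndependent hspan)]
  simp [hσ']
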